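/- **Setting.** There are $N$ items, a collection $\mathbb S$ of nonempty subsets of $[N]$ (assortments), and a known revenue function $r(s,a)\ge 0$ ($s\in\mathbb S$, $a\in s$). A choice model $p$ gives the probability $p(a|s)$ of the choice $a\in s\cup\{0\}$ when $s$ is offered ($0$ means no purchase), and $\mathcal V(s;p)=\sum_{a\in s}p(a|s)r(s,a)$ is the expected revenue. Let $d\ge 1$, $x_1,\dots,x_N\in\mathbb R^d$ with $\max_j\|x_j\|_2\le C_x$, $\Theta\subset\mathbb R^d$ with $\sup_{\theta\in\Theta}\|\theta\|_2\le C_\Theta$, and let $\mathcal P=\{p(\cdot|\cdot;\theta):\theta\in\Theta\}$ be the multinomial logit (MNL) family $$p(a|s;\theta)=\frac{\exp(x_a^\top\theta)}{1+\sum_{j\in s}\exp(x_j^\top\theta)}\ (a\in s),\qquad p(0|s;\theta)=\frac{1}{1+\sum_{j\in s}\exp(x_j^\top\theta)}.$$ The true model $p_0$ belongs to $\mathcal P$. The data $(S_i,A_i)_{i=1}^n$, $n\ge1$, are i.i.d. with probability mass function $(s,a)\mapsto\pi_S(s)p_0(a|s)$, where $\pi_S$ is a probability distribution on $\mathbb S$.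 Coverage at optimum: $s^\star\in\arg\max_{s\in\mathbb S}\mathcal V(s;p_0)$ satisfies $\pi_S(s^\star)>0$. Put $r_{s^\star}=\max_{j\in s^\star}r(s^\star,j)$ and $\mathcal R(s)=\mathcal V(s^\star;p_0)-\mathcal V(s;p_0)$. **PASTA.** With $\widehat L_n(p)=-\frac1n\sum_{i=1}^n\log p(A_i|S_i)$ and a critical value $\alpha>0$, let $\Omega_n(\alpha)=\{p\in\mathcal P:\widehat L_n(p)-\inf_{q\in\mathcal P}\widehat L_n(q)\le\alpha\}$. PASTA outputs any $\widehat s\in\arg\max_{s\in\mathbb S}\inf_{p\in\Omega_n(\alpha)}\mathcal V(s;p)$. **Theorem.** For all $C_\Theta$, $b>1$ and $c_0>0$ there are constants $\kappa,C>0$, depending only on $C_\Theta$, $b$, $c_0$, such that in every setting as above with $n\ge c_0\,d\log(n/d)$ and $C_xn\ge b\,d$, for every $\delta\in(0,1)$ and every $k\ge\kappa$, with the critical value $$\alpha_n(\delta)=k\Big(\frac dn\log\frac{C_xn}{d}+\frac1n\log\frac1\delta\Big),$$ the following holds with probability at least $1-\delta$: every PASTA output $\widehat s$ with uncertainty set $\Omega_n(\alpha_n(\delta))$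 satisfies $$\mathcal R(\widehat s)\le C\,r_{s^\star}\sqrt{\frac{\alpha_n(\delta)}{\pi_S(s^\star)}}.$$ -/

import Mathlib

open MeasureTheory ProbabilityTheory

noncomputable section

namespace Pasta

/-- A choice model on the items `Fin N`: `p s a` is the probability `p(a|s)` of the choice `a`
when the assortment `s` is offered; `none` is the no-purchase option (written `0` on paper). -/
abbrev ChoiceModel (N : ℕ) : Type := Finset (Fin N) → Option (Fin N) → ℝ

/-- One historical record: the offered assortment `S` and the customer's choice `A`. -/
structure Observation (N : ℕ) where
  S : Finset (Fin N)
  A : Option (Fin N)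

/-- Records form a finite type, with every subset measurable. -/
instance (N : ℕ) : MeasurableSpace (Observation N) := ⊤

/-- The offline dataset `Z 0, …, Z (n-1)` is i.i.d. with probability mass function
`(s, a) ↦ π s * p₀(a|s)`. -/
structure IsOfflineData {N n : ℕ} {Ω : Type*} [MeasurableSpace Ω] (μ : Measure Ω)
    (π : PMF (Finset (Fin N))) (p₀ : ChoiceModel N) (Z : Fin n → Ω → Observation N) : Prop where
  measurable : ∀ i, Measurable (Z i)
  indep : iIndepFun Z μ
  law : ∀ i s a, μ (Z i ⁻¹' {⟨s, a⟩}) = π s * ENNReal.ofReal (p₀ s a)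

/-- Expected revenue `𝒱(s; p) = ∑_{a ∈ s} p(a|s) r(s, a)`. -/
def value {N : ℕ} (r : Finset (Fin N) → Fin N → ℝ) (p : ChoiceModel N) (s : Finset (Fin N)) : ℝ :=
  ∑ a ∈ s, p s (some a) * r s a

/-- `s` is optimal in the collection `𝕊` under the choice model `p`. -/
def IsOptimal {N : ℕ} (𝕊 : Finset (Finset (Fin N))) (r : Finset (Fin N) → Fin N → ℝ)
    (p : ChoiceModel N) (s : Finset (Fin N)) : Prop :=
  s ∈ 𝕊 ∧ ∀ s' ∈ 𝕊, value r p s' ≤ value r p s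

/-- Regret of `s` relative to an optimal assortment `sStar`. -/
def regret {N : ℕ} (r : Finset (Fin N) → Fin N → ℝ) (p₀ : ChoiceModel N)
    (sStar s : Finset (Fin N)) : ℝ :=
  value r p₀ sStar - value r p₀ s

/-- `r_s = max_{j ∈ s} r(s, j)`. -/
def maxRevenue {N : ℕ} (r : Finset (Fin N) → Fin N → ℝ) (s : Finset (Fin N)) : ℝ :=
  ⨆ j : {j : Fin N // j ∈ s}, r s j

/-- Average negative log-likelihood of the dataset `D`. -/
def empLoss {N n : ℕ} (D : Fin n → Observation N) (p : ChoiceModel N) : ℝ :=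
  -(1 / (n : ℝ)) * ∑ i, Real.log (p (D i).S (D i).A)

/-- The likelihood-ratio uncertainty set: the models of `P` whose loss exceeds the smallest loss
by at most `α`. If a maximum likelihood estimator exists, the infimum is its loss; writing the
infimum covers classes in which it is not attained. -/
def uncertaintySet {N n : ℕ} (P : Set (ChoiceModel N)) (D : Fin n → Observation N) (α : ℝ) :
    Set (ChoiceModel N) :=
  {p | p ∈ P ∧ empLoss D p - sInf (empLoss D '' P) ≤ α}

/-- Worst-case expected revenue of `s` over a set `U` of choice models. -/
def worstValue {N : ℕ} (r : Finset (Fin N) → Fin N → ℝ) (U : Set (ChoiceModel N))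
    (s : Finset (Fin N)) : ℝ :=
  sInf ((fun p => value r p s) '' U)

/-- The outputs of the pessimistic rule: the maximizers over `𝕊` of the worst-case expected revenue
over the uncertainty set with critical value `α`. -/
def pastaSolutions {N n : ℕ} (𝕊 : Finset (Finset (Fin N))) (r : Finset (Fin N) → Fin N → ℝ)
    (P : Set (ChoiceModel N)) (D : Fin n → Observation N) (α : ℝ) : Set (Finset (Fin N)) :=
  {s | s ∈ 𝕊 ∧ ∀ s' ∈ 𝕊,
    worstValue r (uncertaintySet P D α) s' ≤ worstValue r (uncertaintySet P D α) s}

/-- The multinomial logit model with item features `x` and parameter `θ`. -/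
def mnl {N d : ℕ} (x : Fin N → EuclideanSpace ℝ (Fin d)) (θ : EuclideanSpace ℝ (Fin d)) :
    ChoiceModel N
  | s, none => 1 / (1 + ∑ j ∈ s, Real.exp (inner ℝ (x j) θ))
  | s, some a =>
      if a ∈ s then
        Real.exp (inner ℝ (x a) θ) / (1 + ∑ j ∈ s, Real.exp (inner ℝ (x j) θ))
      else 0

/-- The family of multinomial logit models with parameter in `Θ`. -/
def mnlFamily {N d : ℕ} (x : Fin N → EuclideanSpace ℝ (Fin d))
    (Θ : Set (EuclideanSpace ℝ (Fin d))) : Set (ChoiceModel N) :=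
  mnl x '' Θ

/-- `(d / n) log (Cx n / d) + (1 / n) log (1 / δ)`. -/
def mnlRate (Cx : ℝ) (d n : ℕ) (δ : ℝ) : ℝ :=
  (d : ℝ) / n * Real.log (Cx * n / d) + 1 / (n : ℝ) * Real.log (1 / δ)

end Pasta

end

/-! The argument combines pessimism with a likelihood-ratio bound in Hellinger distance. If the true
model lies in the uncertainty set, pessimism reduces the regret to the error in the value of the
optimal assortment `sStar` alone (`regret_le_of_mem_pastaSolutions`), so coverage is needed only
there.

The square root of a likelihood ratio has mean equal to the average Hellinger affinity. A Chernoff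
bound with exponent 1/2 therefore needs no lower bound on probabilities, and it yields the deficit
`π sStar * (1 - affinity)` in each exponent (`IsOfflineData.measure_le_sum_logRatio_le`). A union
bound over a finite net of parameters, extended by the Lipschitz property of the MNL log-likelihood
(`log_mnl_le`), gives one inequality valid for all of `Θ`. Dropping the deficit, it puts the true
model in the uncertainty set; keeping it, it makes every model of that set Hellinger-close to the
truth on `sStar`. Cauchy–Schwarz turns this into an `ℓ¹` bound and hence a revenue bound. -/

namespace Pasta

/-! ### Packing and covering of Euclidean balls. -/

section Net

variable {E : Type*} [NormedAddCommGroup E] [NormedSpace ℝ E] [FiniteDimensional ℝ E]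

open scoped Function in
/-- An `ε`-separated finite subset of the ball of radius `R` has at most `(1 + 2 R / ε) ^ dim`
points. -/
theorem card_le_of_separated_of_norm_le {R ε : ℝ} (hR : 0 ≤ R) (hε : 0 < ε) (s : Finset E)
    (hs : ∀ c ∈ s, ‖c‖ ≤ R) (h : ∀ c ∈ s, ∀ d ∈ s, c ≠ d → ε ≤ ‖c - d‖) :
    (s.card : ℝ) ≤ (1 + 2 * R / ε) ^ Module.finrank ℝ E := by
  borelize E
  let μ : Measure E := Measure.addHaar
  have hδ : 0 < ε / 2 := by positivity
  have hρ : 0 < R + ε / 2 := by positivity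
  -- Volume comparison: disjoint balls of radius `ε / 2` around the points all fit in the ball of
  -- radius `R + ε / 2`.
  have hD : Set.Pairwise (s : Set E) (Disjoint on fun c => Metric.ball (c : E) (ε / 2)) := by
    rintro c hc d hd hcd
    apply Metric.ball_disjoint_ball
    rw [dist_eq_norm, add_halves]
    exact h c hc d hd hcd
  have hA : (⋃ c ∈ s, Metric.ball (c : E) (ε / 2)) ⊆ Metric.ball (0 : E) (R + ε / 2) := by
    refine Set.iUnion₂_subset fun c hc => Metric.ball_subset_ball' ?_
    rw [dist_zero_right]
    linarith [hs c hc]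
  have hI : (s.card : ENNReal) * ENNReal.ofReal ((ε / 2) ^ Module.finrank ℝ E) *
      μ (Metric.ball 0 1) ≤
      ENNReal.ofReal ((R + ε / 2) ^ Module.finrank ℝ E) * μ (Metric.ball 0 1) := by
    rw [← μ.addHaar_ball_of_pos 0 hρ]
    refine le_trans (le_of_eq ?_) (measure_mono hA)
    rw [measure_biUnion_finset hD fun c _ => measurableSet_ball]
    simp only [μ.addHaar_ball_of_pos _ hδ, Finset.sum_const, nsmul_eq_mul, mul_assoc]
  have hJ := (ENNReal.mul_le_mul_iff_left (Metric.measure_ball_pos _ _ zero_lt_one).ne'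
    measure_ball_lt_top.ne).1 hI
  have hK := ENNReal.toReal_le_of_le_ofReal (by positivity) hJ
  rw [ENNReal.toReal_mul, ENNReal.toReal_natCast, ENNReal.toReal_ofReal (by positivity),
    ← le_div_iff₀ (by positivity), ← div_pow] at hK
  refine hK.trans (le_of_eq ?_)
  congr 1
  field_simp
  ring

/-- The ball of radius `R` has an `ε`-net with at most `(1 + 2 R / ε) ^ dim` points. -/
theorem exists_net_of_norm_le {R ε : ℝ} (hR : 0 ≤ R) (hε : 0 < ε) :
    ∃ T : Finset E, (T.card : ℝ) ≤ (1 + 2 * R / ε) ^ Module.finrank ℝ E ∧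
      ∀ v : E, ‖v‖ ≤ R → ∃ t ∈ T, ‖v - t‖ ≤ ε := by
  classical
  -- A separated set of maximal cardinality is a net, since an uncovered point could be added to it;
  -- the packing bound guarantees that a maximum exists.
  let A : Set ℕ := {m | ∃ s : Finset E, s.card = m ∧ (∀ c ∈ s, ‖c‖ ≤ R) ∧
    ∀ c ∈ s, ∀ d ∈ s, c ≠ d → ε ≤ ‖c - d‖}
  have hne : A.Nonempty := ⟨0, ∅, by simp⟩
  have hbdd : BddAbove A := by
    refine ⟨⌊(1 + 2 * R / ε) ^ Module.finrank ℝ E⌋₊, ?_⟩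
    rintro _ ⟨s, rfl, hs, h⟩
    exact Nat.le_floor (card_le_of_separated_of_norm_le hR hε s hs h)
  obtain ⟨T, hcard, hT, hsep⟩ := Nat.sSup_mem hne hbdd
  refine ⟨T, card_le_of_separated_of_norm_le hR hε T hT hsep, fun v hv => ?_⟩
  by_contra! hfar
  have hvT : v ∉ T := fun hmem => by
    have := hfar v hmem
    rw [sub_self, norm_zero] at this
    linarith
  have hmem : T.card + 1 ∈ A := by
    refine ⟨insert v T, Finset.card_insert_of_notMem hvT, ?_, ?_⟩
    · intro c hc
      rcases Finset.mem_insert.1 hc with rfl | hc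
      exacts [hv, hT c hc]
    · intro c hc d hd hcd
      rcases Finset.mem_insert.1 hc with rfl | hcT <;>
        rcases Finset.mem_insert.1 hd with rfl | hdT
      · exact absurd rfl hcd
      · exact (hfar d hdT).le
      · rw [norm_sub_rev]
        exact (hfar c hcT).le
      · exact hsep c hcT d hdT hcd
  have := le_csSup hbdd hmem
  omega

end Net

/-! ### Hellinger affinity, `ℓ¹` distance and expected revenue. -/

section ChoiceModel

variable {N : ℕ}

/-- The Hellinger affinity of the choice probabilities of `p` and `q` on the assortment `s`. -/
noncomputable def affinity (p q : ChoiceModel N) (s : Finset (Fin N)) : ℝ :=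
  ∑ a, √(p s a * q s a)

theorem affinity_nonneg (p q : ChoiceModel N) (s : Finset (Fin N)) : 0 ≤ affinity p q s :=
  Finset.sum_nonneg fun _ _ => Real.sqrt_nonneg _

theorem affinity_le_one {p q : ChoiceModel N} {s : Finset (Fin N)}
    (hp : ∀ a, 0 ≤ p s a) (hq : ∀ a, 0 ≤ q s a) (hp1 : ∑ a, p s a = 1) (hq1 : ∑ a, q s a = 1) :
    affinity p q s ≤ 1 := by
  have h : affinity p q s ≤ ∑ a, (p s a + q s a) / 2 := by
    refine Finset.sum_le_sum fun a _ => ?_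
    rw [Real.sqrt_mul (hp a)]
    nlinarith [sq_nonneg (√(p s a) - √(q s a)), Real.sq_sqrt (hp a), Real.sq_sqrt (hq a)]
  rw [← Finset.sum_div, Finset.sum_add_distrib, hp1, hq1] at h
  linarith

/-- The squared `ℓ¹` distance is bounded by the Hellinger affinity. -/
theorem sq_sum_abs_sub_le {p q : ChoiceModel N} {s : Finset (Fin N)}
    (hp : ∀ a, 0 ≤ p s a) (hq : ∀ a, 0 ≤ q s a) (hp1 : ∑ a, p s a = 1) (hq1 : ∑ a, q s a = 1) :
    (∑ a, |p s a - q s a|) ^ 2 ≤ 8 * (1 - affinity p q s) := by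
  have hfac : ∀ a, |p s a - q s a| = |√(p s a) - √(q s a)| * (√(p s a) + √(q s a)) := by
    intro a
    rw [← abs_of_nonneg (add_nonneg (Real.sqrt_nonneg (p s a)) (Real.sqrt_nonneg (q s a))),
      ← abs_mul]
    congr 1
    nlinarith [Real.sq_sqrt (hp a), Real.sq_sqrt (hq a)]
  have hsq : ∀ a, √(p s a * q s a) = √(p s a) * √(q s a) := fun a => Real.sqrt_mul (hp a) _
  have hminus : ∑ a, |√(p s a) - √(q s a)| ^ 2 = 2 - 2 * affinity p q s := by
    have : ∀ a, |√(p s a) - √(q s a)| ^ 2 = p s a + q s a - 2 * √(p s a * q s a) := by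
      intro a
      rw [sq_abs, hsq]
      nlinarith [Real.sq_sqrt (hp a), Real.sq_sqrt (hq a)]
    simp only [this, Finset.sum_sub_distrib, Finset.sum_add_distrib, hp1, hq1, ← Finset.mul_sum,
      affinity]
    ring
  have hplus : ∑ a, (√(p s a) + √(q s a)) ^ 2 = 2 + 2 * affinity p q s := by
    have : ∀ a, (√(p s a) + √(q s a)) ^ 2 = p s a + q s a + 2 * √(p s a * q s a) := by
      intro a
      rw [hsq]
      nlinarith [Real.sq_sqrt (hp a), Real.sq_sqrt (hq a)]
    simp only [this, Finset.sum_add_distrib, hp1, hq1, ← Finset.mul_sum, affinity]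
    ring
  -- With affinity `ρ`, Cauchy–Schwarz gives `(2 - 2ρ)(2 + 2ρ) = 4(1 - ρ)(1 + ρ)`, and `ρ ≤ 1`.
  have hcs := Finset.sum_mul_sq_le_sq_mul_sq Finset.univ (fun a => |√(p s a) - √(q s a)|)
    (fun a => √(p s a) + √(q s a))
  rw [hminus, hplus] at hcs
  simp only [hfac]
  refine hcs.trans ?_
  nlinarith [affinity_le_one hp hq hp1 hq1, affinity_nonneg p q s]

/-- Choice probabilities whose logarithms differ by at most `η` are `2 √η`-close in `ℓ¹`. -/
theorem sum_abs_sub_le_of_log_le {p q : ChoiceModel N} {s : Finset (Fin N)} {η : ℝ}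
    (hp : ∀ a, 0 ≤ p s a) (hq : ∀ a, 0 ≤ q s a) (hp1 : ∑ a, p s a = 1) (hq1 : ∑ a, q s a = 1)
    (hpq : ∀ a, (0 < p s a ∧ 0 < q s a) ∨ (p s a = 0 ∧ q s a = 0)) (hη : 0 ≤ η)
    (hle : ∀ a, Real.log (p s a) ≤ Real.log (q s a) + η)
    (hge : ∀ a, Real.log (q s a) ≤ Real.log (p s a) + η) :
    ∑ a, |p s a - q s a| ≤ 2 * √η := by
  have key : ∀ u v : ℝ, 0 < u → 0 < v → Real.log u ≤ Real.log v + η → u - v ≤ η * u := by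
    intro u v hu hv h
    have h1 : u * Real.exp (-η) ≤ v := by
      rw [← Real.exp_log hu, ← Real.exp_log hv, ← Real.exp_add, Real.exp_le_exp]
      linarith
    nlinarith [Real.add_one_le_exp (-η)]
  have hη' : ∑ a, |p s a - q s a| ≤ 2 * η := by
    have h : ∑ a, |p s a - q s a| ≤ ∑ a, η * (p s a + q s a) := by
      refine Finset.sum_le_sum fun a _ => ?_
      rcases hpq a with ⟨h1, h2⟩ | ⟨h1, h2⟩
      · rw [abs_le]
        have h3 := key _ _ h1 h2 (hle a)
        have h4 := key _ _ h2 h1 (hge a)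
        constructor <;> nlinarith
      · simp [h1, h2]
    rw [← Finset.mul_sum, Finset.sum_add_distrib, hp1, hq1] at h
    linarith
  -- The trivial bound handles `η ≥ 1`: both `2 η` for small `η` and `2` for large `η` are below `2
  -- √η`, the scale of the final bound.
  have h2 : ∑ a, |p s a - q s a| ≤ 2 := by
    have h : ∑ a, |p s a - q s a| ≤ ∑ a, (p s a + q s a) := by
      refine Finset.sum_le_sum fun a _ => ?_
      rw [abs_le]
      constructor <;> linarith [hp a, hq a]
    rw [Finset.sum_add_distrib, hp1, hq1] at h
    linarith
  rcases le_total η 1 with h1 | h1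
  · have : η ≤ √η := Real.le_sqrt_of_sq_le (by nlinarith)
    linarith
  · have : 1 ≤ √η := Real.one_le_sqrt.2 h1
    linarith

/-- Expected revenues differ by at most the largest revenue times the `ℓ¹` distance. -/
theorem value_sub_value_le (r : Finset (Fin N) → Fin N → ℝ) (p q : ChoiceModel N)
    {s : Finset (Fin N)} (hr : ∀ a ∈ s, 0 ≤ r s a) :
    value r p s - value r q s ≤ maxRevenue r s * ∑ a, |p s a - q s a| := by
  have hmax : ∀ a ∈ s, r s a ≤ maxRevenue r s := fun a ha =>
    le_ciSup (f := fun j : {j : Fin N // j ∈ s} => r s j) (Set.finite_range _).bddAbove ⟨a, ha⟩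
  have h0 : 0 ≤ maxRevenue r s := Real.iSup_nonneg fun j => hr j j.2
  rw [value, value, ← Finset.sum_sub_distrib, Fintype.sum_option, mul_add, Finset.mul_sum]
  have h1 : ∑ a ∈ s, (p s (some a) * r s a - q s (some a) * r s a) ≤
      ∑ a ∈ s, maxRevenue r s * |p s (some a) - q s (some a)| := by
    refine Finset.sum_le_sum fun a ha => ?_
    rw [← sub_mul, mul_comm (maxRevenue r s)]
    exact mul_le_mul (le_abs_self _) (hmax a ha) (hr a ha) (abs_nonneg _)
  have h2 : ∑ a ∈ s, maxRevenue r s * |p s (some a) - q s (some a)| ≤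
      ∑ a, maxRevenue r s * |p s (some a) - q s (some a)| :=
    Finset.sum_le_sum_of_subset_of_nonneg (Finset.subset_univ _) fun a _ _ => by positivity
  have h3 : 0 ≤ maxRevenue r s * |p s none - q s none| := by positivity
  linarith

end ChoiceModel

/-! ### The multinomial logit model. -/

section Mnl

variable {N d : ℕ} (x : Fin N → EuclideanSpace ℝ (Fin d))

theorem mnl_denominator_pos (θ : EuclideanSpace ℝ (Fin d)) (s : Finset (Fin N)) :
    0 < 1 + ∑ j ∈ s, Real.exp (inner ℝ (x j) θ) := by positivity

theorem mnl_nonneg (θ : EuclideanSpace ℝ (Fin d)) (s : Finset (Fin N)) (a : Option (Fin N)) :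
    0 ≤ mnl x θ s a := by
  have := mnl_denominator_pos x θ s
  cases a with
  | none => simp only [mnl]; positivity
  | some a => simp only [mnl]; split_ifs <;> positivity

theorem sum_mnl (θ : EuclideanSpace ℝ (Fin d)) (s : Finset (Fin N)) :
    ∑ a, mnl x θ s a = 1 := by
  have := mnl_denominator_pos x θ s
  rw [Fintype.sum_option]
  simp only [mnl]
  rw [Finset.sum_ite_mem, Finset.univ_inter, ← Finset.sum_div, ← add_div, div_self this.ne']

theorem mnl_le_one (θ : EuclideanSpace ℝ (Fin d)) (s : Finset (Fin N)) (a : Option (Fin N)) :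
    mnl x θ s a ≤ 1 :=
  (Finset.single_le_sum (fun b _ => mnl_nonneg x θ s b) (Finset.mem_univ a)).trans_eq
    (sum_mnl x θ s)

/-- The support depends on the assortment only, not on the parameter, so likelihood ratios within
the family are never degenerate. -/
theorem mnl_pos_or_eq_zero (θ θ' : EuclideanSpace ℝ (Fin d)) (s : Finset (Fin N))
    (a : Option (Fin N)) :
    (0 < mnl x θ s a ∧ 0 < mnl x θ' s a) ∨ (mnl x θ s a = 0 ∧ mnl x θ' s a = 0) := by
  have h := mnl_denominator_pos x θ s
  have h' := mnl_denominator_pos x θ' s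
  cases a with
  | none => left; simp only [mnl]; constructor <;> positivity
  | some a =>
    by_cases ha : a ∈ s
    · left; simp only [mnl, if_pos ha]; constructor <;> positivity
    · right; simp [mnl, ha]

variable {x}

/-- The log-likelihood of the multinomial logit model is Lipschitz in the parameter. -/
theorem log_mnl_le {Cx : ℝ} (hx : ∀ j, ‖x j‖ ≤ Cx) (hCx : 0 ≤ Cx)
    (θ θ' : EuclideanSpace ℝ (Fin d)) (s : Finset (Fin N)) (a : Option (Fin N)) :
    Real.log (mnl x θ s a) ≤ Real.log (mnl x θ' s a) + 2 * Cx * ‖θ - θ'‖ := by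
  have hu : ∀ (t t' : EuclideanSpace ℝ (Fin d)) (j : Fin N),
      inner ℝ (x j) t ≤ inner ℝ (x j) t' + Cx * ‖t - t'‖ := by
    intro t t' j
    have h1 := real_inner_le_norm (x j) (t - t')
    rw [inner_sub_right] at h1
    nlinarith [hx j, norm_nonneg (t - t')]
  have hD : 0 ≤ Cx * ‖θ' - θ‖ := by positivity
  -- The log-partition function is `Cx`-Lipschitz, as is the utility in the numerator; together they
  -- give the factor 2.
  have hZ : Real.log (1 + ∑ j ∈ s, Real.exp (inner ℝ (x j) θ')) ≤
      Real.log (1 + ∑ j ∈ s, Real.exp (inner ℝ (x j) θ)) + Cx * ‖θ' - θ‖ := by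
    rw [← Real.log_exp (Cx * ‖θ' - θ‖),
      ← Real.log_mul (mnl_denominator_pos x θ s).ne' (Real.exp_pos _).ne']
    refine Real.log_le_log (mnl_denominator_pos x θ' s) ?_
    rw [add_mul, Finset.sum_mul, one_mul]
    refine add_le_add (Real.one_le_exp hD) (Finset.sum_le_sum fun j _ => ?_)
    rw [← Real.exp_add]
    exact Real.exp_le_exp.2 (hu θ' θ j)
  rw [norm_sub_rev θ' θ] at hZ hD
  cases a with
  | none =>
    simp only [mnl, one_div, Real.log_inv]
    linarith
  | some a =>
    by_cases ha : a ∈ s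
    · simp only [mnl, if_pos ha]
      rw [Real.log_div (Real.exp_pos _).ne' (mnl_denominator_pos x θ s).ne',
        Real.log_div (Real.exp_pos _).ne' (mnl_denominator_pos x θ' s).ne',
        Real.log_exp, Real.log_exp]
      linarith [hu θ θ' a]
    -- Both probabilities vanish and `Real.log 0 = 0`.
    · simp only [mnl, if_neg ha]
      linarith

end Mnl


/-! ### Chernoff and union bounds for likelihood ratios. -/

section Likelihood

variable {N n : ℕ}

instance (N : ℕ) : Fintype (Observation N) :=
  Fintype.ofEquiv (Finset (Fin N) × Option (Fin N))
    ⟨fun z => ⟨z.1, z.2⟩, fun z => (z.S, z.A), fun _ => rfl, fun _ => rfl⟩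

instance (N : ℕ) : DiscreteMeasurableSpace (Observation N) := ⟨fun _ => trivial⟩

/-- The log-likelihood ratio of `q` against `p` at the record `z`. -/
noncomputable def logRatio (q p : ChoiceModel N) (z : Observation N) : ℝ :=
  Real.log (q z.S z.A) - Real.log (p z.S z.A)

variable {Ω : Type*} [MeasurableSpace Ω] {μ : Measure Ω} {π : PMF (Finset (Fin N))}
  {p q : ChoiceModel N} {Z : Fin n → Ω → Observation N}

theorem IsOfflineData.lintegral_comp (hZ : IsOfflineData μ π p Z) (i : Fin n)
    (F : Observation N → ENNReal) :
    ∫⁻ ω, F (Z i ω) ∂μ = ∑ s, ∑ a, F ⟨s, a⟩ * (π s * ENNReal.ofReal (p s a)) := by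
  rw [← lintegral_map (measurable_of_countable F) (hZ.measurable i), lintegral_fintype,
    ← Fintype.sum_prod_type' (f := fun s a => F ⟨s, a⟩ * (π s * ENNReal.ofReal (p s a)))]
  symm
  refine Fintype.sum_equiv
    ⟨fun z => ⟨z.1, z.2⟩, fun z => (z.S, z.A), fun _ => rfl, fun _ => rfl⟩ _ _ fun z => ?_
  rw [Measure.map_apply (hZ.measurable i) (MeasurableSet.singleton _), ← hZ.law]
  rfl

/-- The expected square root of the likelihood ratio is the mean Hellinger affinity, hence it is
bounded in terms of the affinity on a single assortment. -/
theorem IsOfflineData.lintegral_exp_logRatio_le (hZ : IsOfflineData μ π p Z)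
    (hp : ∀ s a, 0 ≤ p s a) (hq : ∀ s a, 0 ≤ q s a)
    (hp1 : ∀ s, ∑ a, p s a = 1) (hq1 : ∀ s, ∑ a, q s a = 1)
    (hpq : ∀ s a, (0 < p s a ∧ 0 < q s a) ∨ (p s a = 0 ∧ q s a = 0))
    (i : Fin n) (s₀ : Finset (Fin N)) :
    ∫⁻ ω, ENNReal.ofReal (Real.exp (logRatio q p (Z i ω) / 2)) ∂μ ≤
      ENNReal.ofReal (Real.exp (-((π s₀).toReal * (1 - affinity p q s₀)))) := by
  -- Off the support the exponential takes a default value, but the weight `p s a = 0` removes it.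
  have hterm : ∀ s a, Real.exp (logRatio q p ⟨s, a⟩ / 2) * p s a = √(p s a * q s a) := by
    intro s a
    rcases hpq s a with ⟨h1, h2⟩ | ⟨h1, h2⟩
    · symm
      rw [Real.sqrt_eq_iff_mul_self_eq (by positivity) (by positivity)]
      have : Real.exp (logRatio q p ⟨s, a⟩ / 2) * Real.exp (logRatio q p ⟨s, a⟩ / 2) =
          q s a / p s a := by
        rw [← Real.exp_add, add_halves, logRatio, Real.exp_sub, Real.exp_log h1, Real.exp_log h2]
      rw [mul_mul_mul_comm, this]
      field_simp
    · simp [h1]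
  have hsum : ∀ s, ∑ a, ENNReal.ofReal (Real.exp (logRatio q p ⟨s, a⟩ / 2)) *
      (π s * ENNReal.ofReal (p s a)) = ENNReal.ofReal ((π s).toReal * affinity p q s) := by
    intro s
    rw [ENNReal.ofReal_mul ENNReal.toReal_nonneg, ENNReal.ofReal_toReal (π.apply_ne_top s),
      affinity, ENNReal.ofReal_sum_of_nonneg fun a _ => Real.sqrt_nonneg _, Finset.mul_sum]
    refine Finset.sum_congr rfl fun a _ => ?_
    rw [← hterm, ENNReal.ofReal_mul (Real.exp_pos _).le]
    ring
  rw [hZ.lintegral_comp i fun z => ENNReal.ofReal (Real.exp (logRatio q p z / 2))]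
  simp only [hsum]
  rw [← ENNReal.ofReal_sum_of_nonneg fun s _ =>
    mul_nonneg ENNReal.toReal_nonneg (affinity_nonneg p q s)]
  refine ENNReal.ofReal_le_ofReal (le_trans ?_ (Real.one_sub_le_exp_neg _))
  have hπ : ∑ s, (π s).toReal = 1 := by
    have h := π.tsum_coe
    rw [tsum_fintype] at h
    rw [← ENNReal.toReal_sum fun s _ => π.apply_ne_top s, h, ENNReal.toReal_one]
  have hle : ∀ s, affinity p q s ≤ 1 := fun s =>
    affinity_le_one (hp s) (hq s) (hp1 s) (hq1 s)
  -- Every assortment contributes a nonnegative deficit, so all but `s₀` may be discarded.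
  have hsingle : (π s₀).toReal * (1 - affinity p q s₀) ≤
      ∑ s, (π s).toReal * (1 - affinity p q s) :=
    Finset.single_le_sum (f := fun s => (π s).toReal * (1 - affinity p q s))
      (fun s _ => mul_nonneg ENNReal.toReal_nonneg (sub_nonneg.2 (hle s))) (Finset.mem_univ s₀)
  simp only [mul_sub, mul_one, Finset.sum_sub_distrib, hπ] at hsingle ⊢
  linarith

/-- Chernoff bound for the log-likelihood ratio. -/
theorem IsOfflineData.measure_le_sum_logRatio_le (hZ : IsOfflineData μ π p Z)
    (hp : ∀ s a, 0 ≤ p s a) (hq : ∀ s a, 0 ≤ q s a)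
    (hp1 : ∀ s, ∑ a, p s a = 1) (hq1 : ∀ s, ∑ a, q s a = 1)
    (hpq : ∀ s a, (0 < p s a ∧ 0 < q s a) ∨ (p s a = 0 ∧ q s a = 0))
    (s₀ : Finset (Fin N)) (t : ℝ) :
    μ {ω | t - n * ((π s₀).toReal * (1 - affinity p q s₀)) ≤
      ∑ i, logRatio q p (Z i ω) / 2} ≤ ENNReal.ofReal (Real.exp (-t)) := by
  set c := (π s₀).toReal * (1 - affinity p q s₀)
  let X : Fin n → Ω → ENNReal := fun i ω =>
    ENNReal.ofReal (Real.exp (logRatio q p (Z i ω) / 2))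
  have hX : ∀ i, Measurable (X i) := fun i =>
    (measurable_of_countable fun z : Observation N =>
      ENNReal.ofReal (Real.exp (logRatio q p z / 2))).comp (hZ.measurable i)
  have hindep : iIndepFun X μ :=
    hZ.indep.comp (fun _ z => ENNReal.ofReal (Real.exp (logRatio q p z / 2)))
      fun _ => measurable_of_countable _
  have hprod : ∀ ω, ∏ i, X i ω = ENNReal.ofReal (Real.exp (∑ i, logRatio q p (Z i ω) / 2)) := by
    intro ω
    rw [Real.exp_sum, ENNReal.ofReal_prod_of_nonneg fun i _ => (Real.exp_pos _).le]
  have hint : ∫⁻ ω, ∏ i, X i ω ∂μ ≤ ENNReal.ofReal (Real.exp (-(n * c))) := by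
    rw [lintegral_prod_eq_prod_lintegral_of_indepFun Finset.univ X hindep hX]
    refine (Finset.prod_le_prod' fun i _ =>
      hZ.lintegral_exp_logRatio_le hp hq hp1 hq1 hpq i s₀).trans_eq ?_
    rw [Finset.prod_const, Finset.card_univ, Fintype.card_fin,
      ← ENNReal.ofReal_pow (Real.exp_pos _).le, ← Real.exp_nat_mul, mul_neg]
  have hmarkov := (mul_meas_ge_le_lintegral (μ := μ)
    (Finset.measurable_fun_prod Finset.univ fun i _ => hX i)
    (ENNReal.ofReal (Real.exp (t - n * c)))).trans hint
  simp only [hprod, ENNReal.ofReal_le_ofReal_iff (Real.exp_pos _).le, Real.exp_le_exp] at hmarkov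
  have hpos : ENNReal.ofReal (Real.exp (t - n * c)) ≠ 0 :=
    (ENNReal.ofReal_pos.2 (Real.exp_pos _)).ne'
  rw [← ENNReal.mul_le_mul_iff_right hpos ENNReal.ofReal_ne_top]
  refine hmarkov.trans_eq ?_
  rw [← ENNReal.ofReal_mul (Real.exp_pos _).le, ← Real.exp_add]
  congr 2
  ring

/-- Simultaneous Chernoff bounds over a finite collection of choice models. -/
theorem IsOfflineData.le_measure_forall_sum_logRatio_lt [IsProbabilityMeasure μ] {ι : Type*}
    (hZ : IsOfflineData μ π p Z) (T : Finset ι) (hT : T.Nonempty) (Q : ι → ChoiceModel N)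
    (hp : ∀ s a, 0 ≤ p s a) (hq : ∀ t s a, 0 ≤ Q t s a)
    (hp1 : ∀ s, ∑ a, p s a = 1) (hq1 : ∀ t s, ∑ a, Q t s a = 1)
    (hpq : ∀ t s a, (0 < p s a ∧ 0 < Q t s a) ∨ (p s a = 0 ∧ Q t s a = 0))
    (s₀ : Finset (Fin N)) {δ : ℝ} (hδ : 0 < δ) :
    ENNReal.ofReal (1 - δ) ≤ μ {ω | ∀ t ∈ T, ∑ i, logRatio (Q t) p (Z i ω) / 2 <
      Real.log (T.card / δ) - n * ((π s₀).toReal * (1 - affinity p (Q t) s₀))} := by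
  set G := {ω | ∀ t ∈ T, ∑ i, logRatio (Q t) p (Z i ω) / 2 <
      Real.log (T.card / δ) - n * ((π s₀).toReal * (1 - affinity p (Q t) s₀))}
  let B : ι → Set Ω := fun t => {ω | Real.log (T.card / δ) -
    n * ((π s₀).toReal * (1 - affinity p (Q t) s₀)) ≤ ∑ i, logRatio (Q t) p (Z i ω) / 2}
  have hcard : (0 : ℝ) < T.card := by exact_mod_cast hT.card_pos
  -- Subadditivity over this cover bounds `μ G` from below without requiring `G` to be measurable.
  have hcover : (Set.univ : Set Ω) ⊆ G ∪ ⋃ t ∈ T, B t := by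
    intro ω _
    by_cases h : ω ∈ G
    · exact Or.inl h
    · right
      simp only [G, Set.mem_ofPred_eq, not_forall, not_lt] at h
      obtain ⟨t, ht, h⟩ := h
      exact Set.mem_biUnion ht h
  -- The threshold `log (T.card / δ)` gives each bad event probability at most `δ / T.card`.
  have hB : μ (⋃ t ∈ T, B t) ≤ ENNReal.ofReal δ := by
    refine (measure_biUnion_finset_le T B).trans ?_
    refine (Finset.sum_le_sum fun t _ =>
      hZ.measure_le_sum_logRatio_le hp (hq t) hp1 (hq1 t) (hpq t) s₀ _).trans_eq ?_
    rw [Finset.sum_const, nsmul_eq_mul, Real.exp_neg, Real.exp_log (by positivity),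
      ← ENNReal.ofReal_natCast, ← ENNReal.ofReal_mul hcard.le]
    congr 1
    field_simp
  have h1 : 1 ≤ μ G + ENNReal.ofReal δ := by
    rw [← measure_univ (μ := μ)]
    exact (measure_mono hcover).trans ((measure_union_le _ _).trans (by gcongr))
  rw [ENNReal.ofReal_sub _ hδ.le, ENNReal.ofReal_one]
  exact tsub_le_iff_right.2 h1

end Likelihood

/-! ### Regret of pessimistic solutions. -/

section Pessimism

variable {N n : ℕ}

theorem empLoss_sub_empLoss (D : Fin n → Observation N) (p q : ChoiceModel N) :
    empLoss D p - empLoss D q = (1 / (n : ℝ)) * ∑ i, logRatio q p (D i) := by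
  simp only [empLoss, logRatio, Finset.sum_sub_distrib]
  ring

/-- The regret of a pessimistic solution is at most the largest overestimation, over the
uncertainty set, of the revenue of the reference assortment. -/
theorem regret_le_of_mem_pastaSolutions {𝕊 : Finset (Finset (Fin N))}
    {r : Finset (Fin N) → Fin N → ℝ} {P : Set (ChoiceModel N)} {D : Fin n → Observation N} {α B : ℝ}
    {p₀ : ChoiceModel N} {s₀ s : Finset (Fin N)} (hr : ∀ s ∈ 𝕊, ∀ a ∈ s, 0 ≤ r s a)
    (hP : ∀ p ∈ P, ∀ s a, 0 ≤ p s a) (hs₀ : s₀ ∈ 𝕊) (hp₀ : p₀ ∈ uncertaintySet P D α)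
    (hB : ∀ p ∈ uncertaintySet P D α, value r p₀ s₀ - value r p s₀ ≤ B)
    (hs : s ∈ pastaSolutions 𝕊 r P D α) : regret r p₀ s₀ s ≤ B := by
  have h1 : worstValue r (uncertaintySet P D α) s ≤ value r p₀ s := by
    -- Nonnegative revenues bound the values below, so the real `sInf` is a genuine infimum.
    refine csInf_le ⟨0, ?_⟩ (Set.mem_image_of_mem _ hp₀)
    rintro _ ⟨p, hp, rfl⟩
    exact Finset.sum_nonneg fun a ha => mul_nonneg (hP p hp.1 s _) (hr s hs.1 a ha)
  have h2 : value r p₀ s₀ - B ≤ worstValue r (uncertaintySet P D α) s₀ := by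
    refine le_csInf ⟨_, Set.mem_image_of_mem _ hp₀⟩ ?_
    rintro _ ⟨p, hp, rfl⟩
    linarith [hB p hp]
  have h3 := hs.2 s₀ hs₀
  rw [regret]
  linarith

end Pessimism

/-! ### The deterministic regret bound on the good event. -/

section Mnl

variable {N d n : ℕ} {x : Fin N → EuclideanSpace ℝ (Fin d)} {Θ : Set (EuclideanSpace ℝ (Fin d))}

/-- Probabilities are at most 1, so losses are nonnegative; this makes the `sInf` in
`uncertaintySet` a true lower bound. -/
theorem bddBelow_empLoss_mnlFamily (D : Fin n → Observation N) :
    BddBelow (empLoss D '' mnlFamily x Θ) := by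
  refine ⟨0, ?_⟩
  rintro _ ⟨_, ⟨θ, -, rfl⟩, rfl⟩
  rw [empLoss, neg_mul, neg_nonneg]
  exact mul_nonpos_of_nonneg_of_nonpos (by positivity)
    (Finset.sum_nonpos fun i _ => Real.log_nonpos (mnl_nonneg x θ _ _) (mnl_le_one x θ _ _))

/-- If the log-likelihood ratios on a net of the parameter set obey the Chernoff bounds, then
every pessimistic solution has small regret. -/
theorem regret_le_of_forall_sum_logRatio_lt {Cx η L α c : ℝ} (hn : 0 < n)
    (hx : ∀ j, ‖x j‖ ≤ Cx) (hCx : 0 ≤ Cx) {𝕊 : Finset (Finset (Fin N))}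
    {r : Finset (Fin N) → Fin N → ℝ} (hr : ∀ s ∈ 𝕊, ∀ a ∈ s, 0 ≤ r s a)
    {θ₀ : EuclideanSpace ℝ (Fin d)} (hθ₀ : θ₀ ∈ Θ) {s₀ : Finset (Fin N)} (hs₀ : s₀ ∈ 𝕊)
    (hc : 0 < c) (hc1 : c ≤ 1) (hη : 0 ≤ η) (T : Finset (EuclideanSpace ℝ (Fin d)))
    (hT : ∀ θ ∈ Θ, ∃ t ∈ T, 2 * Cx * ‖θ - t‖ ≤ η) (hηα : η ≤ α) (hα : η + 2 / n * L ≤ α)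
    {D : Fin n → Observation N}
    (hD : ∀ t ∈ T, ∑ i, logRatio (mnl x t) (mnl x θ₀) (D i) / 2 <
      L - n * (c * (1 - affinity (mnl x θ₀) (mnl x t) s₀)))
    {s : Finset (Fin N)} (hs : s ∈ pastaSolutions 𝕊 r (mnlFamily x Θ) D α) :
    regret r (mnl x θ₀) s₀ s ≤ 5 * (maxRevenue r s₀ * √(α / c)) := by
  have hn' : (0 : ℝ) < n := by exact_mod_cast hn
  have hα0 : 0 ≤ α := hη.trans hηα
  have haff : ∀ t, affinity (mnl x θ₀) (mnl x t) s₀ ≤ 1 := fun t =>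
    affinity_le_one (mnl_nonneg x θ₀ s₀) (mnl_nonneg x t s₀) (sum_mnl x θ₀ s₀) (sum_mnl x t s₀)
  -- The uniform likelihood inequality: discretization costs `η`, the union bound `2 L / n`, and `α`
  -- absorbs both. It serves both the membership of the true model and the closeness of the others.
  have hnear : ∀ θ ∈ Θ, ∃ t ∈ T, 2 * Cx * ‖θ - t‖ ≤ η ∧
      empLoss D (mnl x θ₀) - empLoss D (mnl x θ) ≤
        α - 2 * (c * (1 - affinity (mnl x θ₀) (mnl x t) s₀)) := by
    intro θ hθ
    obtain ⟨t, ht, htη⟩ := hT θ hθ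
    refine ⟨t, ht, htη, ?_⟩
    have h1 : ∑ i, logRatio (mnl x θ) (mnl x θ₀) (D i) ≤
        ∑ i, (2 * (logRatio (mnl x t) (mnl x θ₀) (D i) / 2) + η) := by
      refine Finset.sum_le_sum fun i _ => ?_
      have := log_mnl_le hx hCx θ t (D i).S (D i).A
      simp only [logRatio]
      linarith
    rw [Finset.sum_add_distrib, ← Finset.mul_sum, Finset.sum_const, Finset.card_univ,
      Fintype.card_fin, nsmul_eq_mul] at h1
    rw [empLoss_sub_empLoss]
    have h2 := hD t ht
    have h3 : (1 / (n : ℝ)) * ∑ i, logRatio (mnl x θ) (mnl x θ₀) (D i) ≤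
        (1 / (n : ℝ)) * (2 * (L - n * (c * (1 - affinity (mnl x θ₀) (mnl x t) s₀))) + n * η) :=
      mul_le_mul_of_nonneg_left (by linarith) (by positivity)
    refine h3.trans ?_
    have h4 : (1 / (n : ℝ)) * (2 * (L - n * (c * (1 - affinity (mnl x θ₀) (mnl x t) s₀))) + n * η)
        = η + 2 / n * L - 2 * (c * (1 - affinity (mnl x θ₀) (mnl x t) s₀)) := by
      field_simp
      ring
    rw [h4]
    linarith
  have hmem₀ : mnl x θ₀ ∈ mnlFamily x Θ := ⟨θ₀, hθ₀, rfl⟩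
  refine (regret_le_of_mem_pastaSolutions hr ?_ hs₀ ⟨hmem₀, ?_⟩ ?_ hs)
  · rintro _ ⟨θ, -, rfl⟩
    exact mnl_nonneg x θ
  · have : empLoss D (mnl x θ₀) - α ≤ sInf (empLoss D '' mnlFamily x Θ) := by
      refine le_csInf ⟨_, Set.mem_image_of_mem _ hmem₀⟩ ?_
      rintro _ ⟨_, ⟨θ, hθ, rfl⟩, rfl⟩
      obtain ⟨t, -, -, h⟩ := hnear θ hθ
      have := mul_nonneg hc.le (sub_nonneg.2 (haff t))
      linarith
    linarith
  · rintro _ ⟨⟨θ, hθ, rfl⟩, hle⟩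
    have hinf : sInf (empLoss D '' mnlFamily x Θ) ≤ empLoss D (mnl x θ₀) :=
      csInf_le (bddBelow_empLoss_mnlFamily D) (Set.mem_image_of_mem _ hmem₀)
    obtain ⟨t, ht, htη, h⟩ := hnear θ hθ
    -- Membership in the uncertainty set bounds the loss difference in `h` below by `-α`, hence `2 c
    -- (1 - affinity) ≤ 2 α`.
    have hh : 1 - affinity (mnl x θ₀) (mnl x t) s₀ ≤ α / c := by
      rw [le_div_iff₀ hc]
      linarith
    -- The constant 3 is a rounding of `√8`.
    have hfar : ∑ a, |mnl x θ₀ s₀ a - mnl x t s₀ a| ≤ 3 * √(α / c) := by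
      have h1 := sq_sum_abs_sub_le (mnl_nonneg x θ₀ s₀) (mnl_nonneg x t s₀) (sum_mnl x θ₀ s₀)
        (sum_mnl x t s₀)
      have hac : 0 ≤ α / c := by positivity
      refine abs_le_of_sq_le_sq' ?_ (by positivity) |>.2
      rw [mul_pow, Real.sq_sqrt hac]
      linarith
    have hclose : ∑ a, |mnl x t s₀ a - mnl x θ s₀ a| ≤ 2 * √(α / c) := by
      refine (sum_abs_sub_le_of_log_le (mnl_nonneg x t s₀) (mnl_nonneg x θ s₀) (sum_mnl x t s₀)
        (sum_mnl x θ s₀) (mnl_pos_or_eq_zero x t θ s₀) hη (fun a => ?_) fun a => ?_).trans ?_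
      · have := log_mnl_le hx hCx t θ s₀ a
        rw [norm_sub_rev] at this
        linarith
      · linarith [log_mnl_le hx hCx θ t s₀ a]
      -- Since `c ≤ 1`, the discretization error `η ≤ α` is also below `α / c`.
      · have : √η ≤ √(α / c) := Real.sqrt_le_sqrt (hηα.trans (le_div_self hα0 hc hc1))
        linarith
    have htri : ∑ a, |mnl x θ₀ s₀ a - mnl x θ s₀ a| ≤ 5 * √(α / c) := by
      have : ∑ a, |mnl x θ₀ s₀ a - mnl x θ s₀ a| ≤
          ∑ a, (|mnl x θ₀ s₀ a - mnl x t s₀ a| + |mnl x t s₀ a - mnl x θ s₀ a|) :=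
        Finset.sum_le_sum fun a _ => abs_sub_le _ _ _
      rw [Finset.sum_add_distrib] at this
      linarith
    have hmax : 0 ≤ maxRevenue r s₀ := Real.iSup_nonneg fun j => hr s₀ hs₀ j j.2
    refine (value_sub_value_le r _ _ (hr s₀ hs₀)).trans ?_
    calc maxRevenue r s₀ * ∑ a, |mnl x θ₀ s₀ a - mnl x θ s₀ a|
        ≤ maxRevenue r s₀ * (5 * √(α / c)) := mul_le_mul_of_nonneg_left htri hmax
      _ = 5 * (maxRevenue r s₀ * √(α / c)) := by ring

end Mnl

/-! ### Calibration of the critical value. -/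

/-- The critical value dominates the discretization error and the union bound of a net. -/
theorem mnlRate_bounds {b R Cx δ m : ℝ} {d n : ℕ} (hb : 1 < b) (hR : 0 ≤ R) (hd : 0 < d)
    (hn : 0 < n) (hbd : b * (d : ℝ) ≤ Cx * n) (hδ : 0 < δ) (hδ1 : δ < 1) (hm : 0 < m)
    (hmle : m ≤ (1 + 4 * R * (Cx * n / d)) ^ d) :
    0 ≤ mnlRate Cx d n δ ∧ (d : ℝ) / n ≤ 1 / Real.log b * mnlRate Cx d n δ ∧
      2 / n * Real.log (m / δ) ≤
        2 * (1 + Real.log (1 + 4 * R) / Real.log b) * mnlRate Cx d n δ := by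
  have hn' : (0 : ℝ) < n := by exact_mod_cast hn
  have hd' : (0 : ℝ) < d := by exact_mod_cast hd
  set y := Cx * n / d with hy
  have hby : b ≤ y := (le_div_iff₀ hd').2 hbd
  have hlb : 0 < Real.log b := Real.log_pos hb
  have hly : Real.log b ≤ Real.log y := Real.log_le_log (by linarith) hby
  have hlδ : 0 < Real.log (1 / δ) := Real.log_pos ((one_lt_div hδ).2 hδ1)
  have hlR : 0 ≤ Real.log (1 + 4 * R) := Real.log_nonneg (by linarith)
  have hrate : mnlRate Cx d n δ = (d : ℝ) / n * Real.log y + 1 / (n : ℝ) * Real.log (1 / δ) := rfl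
  have hdn : (0 : ℝ) < d / n := by positivity
  have hu : 0 ≤ 1 / (n : ℝ) * Real.log (1 / δ) := by positivity
  have hv : (d : ℝ) / n * Real.log b ≤ mnlRate Cx d n δ := by
    rw [hrate]
    nlinarith
  have hv0 : 0 ≤ mnlRate Cx d n δ := le_trans (by positivity) hv
  refine ⟨hv0, ?_, ?_⟩
  · rw [one_div, inv_mul_eq_div, le_div_iff₀ hlb]
    exact hv
  · set K := 1 + Real.log (1 + 4 * R) / Real.log b with hK
    have hK1 : 1 ≤ K := by
      rw [hK]
      have : 0 ≤ Real.log (1 + 4 * R) / Real.log b := by positivity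
      linarith
    -- As `y ≥ b > 1`, `log y` is bounded away from 0 and absorbs the additive constant `log (1 + 4
    -- R)` at the price of the factor `K`.
    have hlm : Real.log m ≤ d * (K * Real.log y) := by
      have h1 : 1 + 4 * R * y ≤ (1 + 4 * R) * y := by nlinarith
      have h0 : 0 < 1 + 4 * R * y := by nlinarith [mul_nonneg hR (by linarith : 0 ≤ y)]
      have h2 := Real.log_le_log hm hmle
      rw [Real.log_pow] at h2
      refine h2.trans (mul_le_mul_of_nonneg_left ?_ hd'.le)
      refine (Real.log_le_log h0 h1).trans ?_
      rw [Real.log_mul (by linarith) (by linarith)]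
      have h3 : Real.log (1 + 4 * R) ≤ Real.log (1 + 4 * R) / Real.log b * Real.log y := by
        rw [div_mul_eq_mul_div, le_div_iff₀ hlb]
        exact mul_le_mul_of_nonneg_left hly hlR
      rw [hK]
      linarith
    have hsplit : Real.log (m / δ) = Real.log m + Real.log (1 / δ) := by
      rw [← Real.log_mul hm.ne' (by positivity), mul_one_div]
    calc 2 / n * Real.log (m / δ)
        ≤ 2 / n * (K * (d * Real.log y) + K * Real.log (1 / δ)) := by
          refine mul_le_mul_of_nonneg_left ?_ (by positivity)
          rw [hsplit]
          nlinarith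
      _ = 2 * K * mnlRate Cx d n δ := by
          rw [hrate]
          ring

end Pasta

/-! ### The main theorem. -/

theorem mainTheorem3 (CΘ b c₀ : ℝ) (hb : 1 < b) (hc₀ : 0 < c₀) :
    ∃ κ : ℝ, 0 < κ ∧ ∃ C : ℝ, 0 < C ∧
      ∀ (N d n : ℕ), 0 < d → 0 < n →
      -- the MNL model with bounded features and a bounded parameter set
      ∀ (Cx : ℝ) (x : Fin N → EuclideanSpace ℝ (Fin d)), (∀ j, ‖x j‖ ≤ Cx) →
      ∀ Θ : Set (EuclideanSpace ℝ (Fin d)), (∀ θ ∈ Θ, ‖θ‖ ≤ CΘ) →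
      -- sample size
      c₀ * ((d : ℝ) * Real.log ((n : ℝ) / d)) ≤ n →
      b * (d : ℝ) ≤ Cx * n →
      -- assortments under consideration and the known revenue function
      ∀ 𝕊 : Finset (Finset (Fin N)), (∀ s ∈ 𝕊, s.Nonempty) →
      ∀ r : Finset (Fin N) → Fin N → ℝ, (∀ s ∈ 𝕊, ∀ a ∈ s, 0 ≤ r s a) →
      -- distribution of the offered assortments, and correct specification
      ∀ π : PMF (Finset (Fin N)), (∀ s, s ∉ 𝕊 → π s = 0) →
      ∀ p₀ ∈ Pasta.mnlFamily x Θ,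
      -- coverage at optimum
      ∀ sStar : Finset (Fin N), Pasta.IsOptimal 𝕊 r p₀ sStar → 0 < π sStar →
      -- offline data
      ∀ (Ω : Type*) [MeasurableSpace Ω] (μ : Measure Ω) [IsProbabilityMeasure μ]
        (Z : Fin n → Ω → Pasta.Observation N), Pasta.IsOfflineData μ π p₀ Z →
      -- confidence level and critical value
      ∀ δ : ℝ, 0 < δ → δ < 1 →
      ∀ k : ℝ, κ ≤ k → ∀ α : ℝ, α = k * Pasta.mnlRate Cx d n δ →
        ENNReal.ofReal (1 - δ) ≤
          μ {ω | ∀ s ∈ Pasta.pastaSolutions 𝕊 r (Pasta.mnlFamily x Θ) (fun i => Z i ω) α,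
            Pasta.regret r p₀ sStar s ≤
              C * (Pasta.maxRevenue r sStar * Real.sqrt (α / (π sStar).toReal))} := by
  have hlb : 0 < Real.log b := Real.log_pos hb
  have hlC : 0 ≤ Real.log (1 + 4 * |CΘ|) := Real.log_nonneg (by linarith [abs_nonneg CΘ])
  set K := 1 + Real.log (1 + 4 * |CΘ|) / Real.log b with hK
  have hK1 : 1 ≤ K := by
    have : 0 ≤ Real.log (1 + 4 * |CΘ|) / Real.log b := by positivity
    linarith
  -- In `κ`, the term `1 / log b` pays for the discretization error `d / n` and `2 K` for the union
  -- bound; 5 is the sum of the `ℓ¹` constants 3 (model to net point) and 2 (net resolution).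
  refine ⟨1 / Real.log b + 2 * K, by positivity, 5, by norm_num, ?_⟩
  rintro N d n hd hn Cx x hx Θ hΘ - hbd 𝕊 - r hr π - _ ⟨θ₀, hθ₀, rfl⟩ s₀ hs₀ hπ Ω _ μ _ Z hZ
    δ hδ hδ1 k hk α rfl
  have hn' : (0 : ℝ) < n := by exact_mod_cast hn
  have hd' : (0 : ℝ) < d := by exact_mod_cast hd
  have hCx : 0 < Cx := by
    have : 0 < Cx * n := lt_of_lt_of_le (by positivity) hbd
    exact pos_of_mul_pos_left this hn'.le
  -- The net resolution `ε` is chosen so that the log-likelihood error `2 * Cx * ε` equals `d / n`.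
  have hε : 0 < (d : ℝ) / (2 * n * Cx) := by positivity
  obtain ⟨T, hTcard, hT⟩ := Pasta.exists_net_of_norm_le (E := EuclideanSpace ℝ (Fin d))
    (abs_nonneg CΘ) hε
  have hΘ' : ∀ θ ∈ Θ, ‖θ‖ ≤ |CΘ| := fun θ hθ => (hΘ θ hθ).trans (le_abs_self _)
  have hTne : T.Nonempty := by
    obtain ⟨t, ht, -⟩ := hT θ₀ (hΘ' θ₀ hθ₀)
    exact ⟨t, ht⟩
  have hcover : ∀ θ ∈ Θ, ∃ t ∈ T, 2 * Cx * ‖θ - t‖ ≤ d / n := by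
    intro θ hθ
    obtain ⟨t, ht, h⟩ := hT θ (hΘ' θ hθ)
    refine ⟨t, ht, (mul_le_mul_of_nonneg_left h (by positivity)).trans_eq ?_⟩
    field_simp
  have hmle : (T.card : ℝ) ≤ (1 + 4 * |CΘ| * (Cx * n / d)) ^ d := by
    rw [finrank_euclideanSpace_fin] at hTcard
    refine hTcard.trans_eq ?_
    congr 2
    field_simp
    ring
  obtain ⟨hrate, h1, h2⟩ := Pasta.mnlRate_bounds hb (abs_nonneg CΘ) hd hn hbd hδ hδ1
    (by exact_mod_cast hTne.card_pos) hmle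
  have hkrate := mul_le_mul_of_nonneg_right hk hrate
  rw [← hK] at h2
  have hprod : 0 ≤ 2 * K * Pasta.mnlRate Cx d n δ := by positivity
  have hπ1 : (π s₀).toReal ≤ 1 := ENNReal.toReal_mono ENNReal.one_ne_top (π.coe_le_one s₀)
  refine (hZ.le_measure_forall_sum_logRatio_lt T hTne (Pasta.mnl x) (Pasta.mnl_nonneg x θ₀)
    (Pasta.mnl_nonneg x) (Pasta.sum_mnl x θ₀) (Pasta.sum_mnl x)
    (fun t s a => Pasta.mnl_pos_or_eq_zero x θ₀ t s a) s₀ hδ).trans (measure_mono ?_)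
  intro ω hω s hs
  exact Pasta.regret_le_of_forall_sum_logRatio_lt hn hx hCx.le hr hθ₀ hs₀.1
    (ENNReal.toReal_pos hπ.ne' (π.apply_ne_top s₀)) hπ1 (by positivity) T hcover
    (by linarith) (by linarith) hω hs
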